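/- Let $R$ be a commutative ring with unit, let $X$ and $Y$ be path-connected topological spaces, and let $f,g\colon X\to Y$ be continuous maps. Write $H^*(-;R)=\bigoplus_{m\ge 0}H^m(-;R)$ for singular cohomology with coefficients in $R$, regarded as a ring under the cup product, and let $\mathcal J(f,g;R)\subseteq H^*(X;R)$ be the image of $f^*-g^*\colon H^*(Y;R)\to H^*(X;R)$. For a subset $S\subseteq H^*(X;R)$, let $\mathrm{l.c.p.}\,S\in\{0,1,2,\dots\}\cup\{\infty\}$ be the least integer $n\ge 0$ such that every product of $n+1$ elements of $S$ vanishes, with $\mathrm{l.c.p.}\,S=\infty$ if there is no such $n$. Then $$\mathrm{l.c.p.}\,\mathcal J(f,g;R)=\mathrm{l.c.p.}\,\langle\mathcal J(f,g;R)\rangle,$$ where $\langle\mathcal J(f,g;R)\rangle$ denotes the two-sided ideal of the ring $H^*(X;R)$ generated by $\mathcal J(f,g;R)$. -/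

import Mathlib

open scoped DirectSum

noncomputable section

namespace SingularCohomology

universe u v w

/-! ### Singular simplices -/

/-- Singular `n`-simplices of `X`: continuous maps from the standard `n`-simplex to `X`. -/
abbrev Simp (X : Type u) [TopologicalSpace X] (n : ℕ) : Type u :=
  C(stdSimplex ℝ (Fin (n + 1)), X)

/-- The affine map between standard simplices given by a map on vertices. -/
def affine {m n : ℕ} (θ : Fin (m + 1) → Fin (n + 1)) :
    C(stdSimplex ℝ (Fin (m + 1)), stdSimplex ℝ (Fin (n + 1))) :=
  ⟨stdSimplex.map θ, stdSimplex.continuous_map θ⟩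

variable {X : Type u} [TopologicalSpace X]

/-- Precomposition of a singular simplex with the affine map given by a map on vertices. -/
def Simp.pull {m n : ℕ} (σ : Simp X n) (θ : Fin (m + 1) → Fin (n + 1)) : Simp X m :=
  σ.comp (affine θ)

lemma Simp.pull_pull {l m n : ℕ} (σ : Simp X n) (θ : Fin (m + 1) → Fin (n + 1))
    (η : Fin (l + 1) → Fin (m + 1)) : (σ.pull θ).pull η = σ.pull (θ ∘ η) := by
  ext x
  simp [Simp.pull, affine, stdSimplex.map_comp_apply]

lemma Simp.pull_id {n : ℕ} (σ : Simp X n) : σ.pull id = σ := by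
  ext x
  simp [Simp.pull, affine]

lemma Simp.comp_pull {Y : Type v} [TopologicalSpace Y] (f : C(X, Y)) {m n : ℕ} (σ : Simp X n)
    (θ : Fin (m + 1) → Fin (n + 1)) : Simp.pull (f.comp σ) θ = f.comp (σ.pull θ) := rfl

/-! ### Singular cochains -/

/-- Singular `n`-cochains of `X` with coefficients in `R`: functions on singular `n`-simplices,
that is, homomorphisms from the free abelian group on the singular `n`-simplices to `R`. -/
abbrev Cochain (R : Type w) (X : Type u) [TopologicalSpace X] (n : ℕ) : Type (max u w) :=
  Simp X n → R

variable {R : Type w} [CommRing R]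

/-- The singular coboundary `(dφ)(σ) = ∑ i, (-1)^i φ(σ ∘ δᵢ)`. -/
def d (n : ℕ) : Cochain R X n →ₗ[R] Cochain R X (n + 1) where
  toFun φ σ := ∑ i : Fin (n + 2), (-1) ^ (i : ℕ) * φ (σ.pull i.succAbove)
  map_add' φ ψ := by
    ext σ
    simp [mul_add, Finset.sum_add_distrib]
  map_smul' r φ := by
    ext σ
    simp [Finset.mul_sum, mul_left_comm]

lemma d_apply {n : ℕ} (φ : Cochain R X n) (σ : Simp X (n + 1)) :
    d n φ σ = ∑ i : Fin (n + 2), (-1) ^ (i : ℕ) * φ (σ.pull i.succAbove) := rfl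

/-- The front `p`-face of an `n`-simplex, on vertices. -/
def front {p n : ℕ} (h : p ≤ n) (i : Fin (p + 1)) : Fin (n + 1) :=
  ⟨i, by omega⟩

/-- The back face of an `n`-simplex with first vertex `p` (with `p + q = n`), on vertices. -/
def back {p q n : ℕ} (h : p + q = n) (i : Fin (q + 1)) : Fin (n + 1) :=
  ⟨p + i, by omega⟩

/-- The cup product of cochains (Alexander–Whitney formula):
`(φ ⌣ ψ)(σ) = φ(σ|[v₀,…,v_p]) ψ(σ|[v_p,…,v_{p+q}])`. -/
def cup {p q n : ℕ} (h : p + q = n) (φ : Cochain R X p) (ψ : Cochain R X q) : Cochain R X n :=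
  fun σ => φ (σ.pull (front (by omega))) * ψ (σ.pull (back h))

lemma sum_split {a b N : ℕ} (h : a + b = N) (F : Fin N → R) :
    ∑ i, F i = ∑ i : Fin a, F ⟨i, by omega⟩ + ∑ j : Fin b, F ⟨a + j, by omega⟩ := by
  subst h
  rw [Fin.sum_univ_add]
  rfl

lemma d_cup {p q n : ℕ} (h : p + q = n) (φ : Cochain R X p) (ψ : Cochain R X q) :
    d n (cup h φ ψ) = cup (by omega) (d p φ) ψ + (-1 : R) ^ p • cup (by omega) φ (d q ψ) := by
  ext σ
  simp only [d_apply, Pi.add_apply, Pi.smul_apply, smul_eq_mul, cup, Simp.pull_pull]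
  rw [sum_split (a := p + 1) (b := q + 1) (by omega), Fin.sum_univ_castSucc (n := p + 1),
    Fin.sum_univ_succ (n := q + 1)]
  simp only [add_mul, mul_add, Finset.sum_mul, Finset.mul_sum]
  have e1 : ∀ i : Fin (p + 1),
      (-1 : R) ^ (i : ℕ) * (φ (σ.pull ((⟨i, by omega⟩ : Fin (n + 2)).succAbove ∘
          front (p := p) (by omega))) *
        ψ (σ.pull ((⟨i, by omega⟩ : Fin (n + 2)).succAbove ∘ back h))) =
      (-1) ^ (i.castSucc : ℕ) * φ (σ.pull (front (n := n + 1) (by omega) ∘ i.castSucc.succAbove)) *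
        ψ (σ.pull (back (p := p + 1) (q := q) (by omega))) := by
    intro i
    have a1 : ((⟨i, by omega⟩ : Fin (n + 2)).succAbove ∘ front (p := p) (by omega)) =
        front (n := n + 1) (by omega) ∘ i.castSucc.succAbove := by
      ext j
      simp only [Function.comp, front, Fin.succAbove, Fin.lt_def]
      split_ifs <;> simp_all <;> omega
    have a2 : ((⟨i, by omega⟩ : Fin (n + 2)).succAbove ∘ back h) =
        back (p := p + 1) (q := q) (by omega) := by
      ext j
      simp only [Function.comp, back, Fin.succAbove, Fin.lt_def]
      split_ifs <;> simp_all <;> omega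
    rw [a1, a2, Fin.val_castSucc, mul_assoc]
  have e2 : ∀ j : Fin (q + 1),
      (-1 : R) ^ (p + 1 + (j : ℕ)) * (φ (σ.pull ((⟨p + 1 + j, by omega⟩ : Fin (n + 2)).succAbove ∘
          front (p := p) (by omega))) *
        ψ (σ.pull ((⟨p + 1 + j, by omega⟩ : Fin (n + 2)).succAbove ∘ back h))) =
      (-1) ^ p * (φ (σ.pull (front (n := n + 1) (by omega))) * ((-1) ^ (j.succ : ℕ) *
        ψ (σ.pull (back (p := p) (q := q + 1) (n := n + 1) (by omega) ∘ j.succ.succAbove)))) := by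
    intro j
    have a1 : ((⟨p + 1 + j, by omega⟩ : Fin (n + 2)).succAbove ∘ front (p := p) (by omega)) =
        front (n := n + 1) (by omega) := by
      ext i
      simp only [Function.comp, front, Fin.succAbove, Fin.lt_def]
      split_ifs <;> simp_all <;> omega
    have a2 : ((⟨p + 1 + j, by omega⟩ : Fin (n + 2)).succAbove ∘ back h) =
        back (p := p) (q := q + 1) (n := n + 1) (by omega) ∘ j.succ.succAbove := by
      ext i
      simp only [Function.comp, back, Fin.succAbove, Fin.lt_def]
      split_ifs <;> simp_all <;> omega
    rw [a1, a2, Fin.val_succ]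
    ring
  have e3 : (front (n := n + 1) (p := p + 1) (by omega)) ∘ (Fin.last (p + 1)).succAbove =
      front (n := n + 1) (p := p) (by omega) := by
    ext i
    simp [front]
  have e4 : (back (p := p) (q := q + 1) (n := n + 1) (by omega)) ∘ (0 : Fin (q + 2)).succAbove =
      back (p := p + 1) (q := q) (n := n + 1) (by omega) := by
    ext i
    simp [back]
    omega
  rw [Finset.sum_congr rfl (fun i _ => e1 i), Finset.sum_congr rfl (fun j _ => e2 j), e3, e4]
  simp only [Fin.val_last, Fin.val_zero]
  ring

lemma d_comp_d {n : ℕ} (φ : Cochain R X n) : d (n + 1) (d n φ) = 0 := by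
  ext σ
  simp only [d_apply, Finset.mul_sum, Pi.zero_apply, Simp.pull_pull]
  rw [← Finset.sum_product']
  refine Finset.sum_involution (fun x _ => (x.1.succAbove x.2, x.2.predAbove x.1)) ?_ ?_
    (fun _ _ => by simp) ?_
  · rintro ⟨i, j⟩ -
    have h : (i.succAbove j).succAbove ∘ (j.predAbove i).succAbove =
        i.succAbove ∘ j.succAbove := by
      ext k
      simp only [Function.comp, Fin.succAbove_succAbove_succAbove_predAbove]
    simp only [h, ← mul_assoc, ← pow_add, Fin.neg_one_pow_succAbove_add_predAbove]
    ring
  · rintro ⟨i, j⟩ - - h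
    exact Fin.succAbove_ne i j (congrArg Prod.fst h)
  · rintro ⟨i, j⟩ -
    simp [Fin.succAbove_succAbove_predAbove, Fin.predAbove_predAbove_succAbove]

/-! ### Singular cohomology -/

/-- Singular cocycles. -/
def cocycles (R : Type w) [CommRing R] (X : Type u) [TopologicalSpace X] (n : ℕ) :
    Submodule R (Cochain R X n) :=
  LinearMap.ker (d n)

/-- Singular coboundaries. -/
def coboundaries (R : Type w) [CommRing R] (X : Type u) [TopologicalSpace X] :
    (n : ℕ) → Submodule R (Cochain R X n)
  | 0 => ⊥
  | n + 1 => LinearMap.range (d n)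

lemma mem_cocycles {n : ℕ} {φ : Cochain R X n} : φ ∈ cocycles R X n ↔ d n φ = 0 := Iff.rfl

lemma coboundaries_le_cocycles (n : ℕ) : coboundaries R X n ≤ cocycles R X n := by
  cases n with
  | zero => exact bot_le
  | succ n =>
    rintro _ ⟨φ, rfl⟩
    exact d_comp_d φ

/-- The singular cohomology `Hⁿ(X; R)`: cocycles modulo coboundaries. -/
def Cohomology (R : Type w) [CommRing R] (X : Type u) [TopologicalSpace X] (n : ℕ) :
    Type (max u w) :=
  cocycles R X n ⧸ (coboundaries R X n).submoduleOf (cocycles R X n)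

instance (n : ℕ) : AddCommGroup (Cohomology R X n) :=
  inferInstanceAs (AddCommGroup
    (cocycles R X n ⧸ (coboundaries R X n).submoduleOf (cocycles R X n)))

instance (n : ℕ) : Module R (Cohomology R X n) :=
  inferInstanceAs (Module R
    (cocycles R X n ⧸ (coboundaries R X n).submoduleOf (cocycles R X n)))

/-- The cohomology class of a cocycle. -/
def Cohomology.mk (n : ℕ) : cocycles R X n →ₗ[R] Cohomology R X n :=
  ((coboundaries R X n).submoduleOf (cocycles R X n)).mkQ

lemma Cohomology.mk_surjective (n : ℕ) :
    Function.Surjective (Cohomology.mk (R := R) (X := X) n) :=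
  Submodule.mkQ_surjective _

lemma Cohomology.mk_eq_zero {n : ℕ} (z : cocycles R X n) :
    Cohomology.mk n z = 0 ↔ (z : Cochain R X n) ∈ coboundaries R X n :=
  Submodule.Quotient.mk_eq_zero _

/-! ### The cup product in cohomology -/

/-- The cup product of cocycles. -/
def cupCocycle (p q : ℕ) :
    cocycles R X p →ₗ[R] cocycles R X q →ₗ[R] cocycles R X (p + q) :=
  LinearMap.mk₂ R
    (fun a b => ⟨cup rfl a.1 b.1, by
      rw [mem_cocycles, d_cup, mem_cocycles.1 a.2, mem_cocycles.1 b.2]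
      ext σ
      simp [cup]⟩)
    (fun a b c => by ext σ; simp [cup, add_mul])
    (fun r a b => by ext σ; simp [cup, mul_assoc])
    (fun a b c => by ext σ; simp [cup, mul_add])
    (fun r a b => by ext σ; simp [cup, mul_left_comm])

lemma cup_mem_of_left {p q n : ℕ} (h : p + q = n) {φ : Cochain R X p}
    (hφ : φ ∈ coboundaries R X p) {ψ : Cochain R X q} (hψ : ψ ∈ cocycles R X q) :
    cup h φ ψ ∈ coboundaries R X n := by
  cases p with
  | zero =>
    obtain rfl : φ = 0 := hφ
    have : cup h (0 : Cochain R X 0) ψ = 0 := by ext σ; simp [cup]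
    rw [this]
    exact zero_mem _
  | succ p =>
    obtain ⟨φ, rfl⟩ := hφ
    obtain rfl : p + q + 1 = n := by omega
    refine ⟨cup rfl φ ψ, ?_⟩
    rw [d_cup, mem_cocycles.1 hψ]
    ext σ
    simp [cup]

lemma cup_mem_of_right {p q n : ℕ} (h : p + q = n) {φ : Cochain R X p}
    (hφ : φ ∈ cocycles R X p) {ψ : Cochain R X q} (hψ : ψ ∈ coboundaries R X q) :
    cup h φ ψ ∈ coboundaries R X n := by
  cases q with
  | zero =>
    obtain rfl : ψ = 0 := hψ
    have : cup h φ (0 : Cochain R X 0) = 0 := by ext σ; simp [cup]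
    rw [this]
    exact zero_mem _
  | succ q =>
    obtain ⟨ψ, rfl⟩ := hψ
    obtain rfl : p + q + 1 = n := by omega
    refine ⟨(-1 : R) ^ p • cup rfl φ ψ, ?_⟩
    rw [map_smul, d_cup, mem_cocycles.1 hφ, smul_add, smul_smul, ← mul_pow]
    ext σ
    simp [cup]

/-- The cup product `Hᵖ(X; R) × H^q(X; R) → H^{p+q}(X; R)`. -/
def cupH (p q : ℕ) :
    Cohomology R X p →ₗ[R] Cohomology R X q →ₗ[R] Cohomology R X (p + q) :=
  LinearMap.liftQ₂ _ _ ((cupCocycle p q).compr₂ (Cohomology.mk (p + q)))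
    (fun a ha => by
      rw [LinearMap.mem_ker]
      ext b
      exact (Cohomology.mk_eq_zero _).2 (cup_mem_of_left rfl ha b.2))
    (fun b hb => by
      rw [LinearMap.mem_ker]
      ext a
      exact (Cohomology.mk_eq_zero _).2 (cup_mem_of_right rfl a.2 hb))

lemma cupH_mk {p q : ℕ} (a : cocycles R X p) (b : cocycles R X q) :
    cupH p q (Cohomology.mk p a) (Cohomology.mk q b) =
      Cohomology.mk (p + q) (cupCocycle p q a b) := rfl

/-- The unit cocycle, the constant function `1` on singular `0`-simplices. -/
def oneCocycle : cocycles R X 0 :=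
  ⟨fun _ => 1, by
    rw [mem_cocycles]
    ext σ
    simp [d_apply, Fin.sum_univ_two]⟩

lemma gradedMonoid_mk_eq {m n : ℕ} (h : m = n) (a : cocycles R X m) (b : cocycles R X n)
    (hab : ∀ σ : Simp X n, a.1 (σ.pull (Fin.cast (by rw [h]))) = b.1 σ) :
    (GradedMonoid.mk m (Cohomology.mk m a) : GradedMonoid (Cohomology R X)) =
      GradedMonoid.mk n (Cohomology.mk n b) := by
  subst h
  congr 2
  ext σ
  exact (congrArg a.1 (Simp.pull_id σ)).symm.trans (hab σ)

instance : GradedMonoid.GMul (Cohomology R X) where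
  mul {p q} a b := cupH p q a b

instance : GradedMonoid.GOne (Cohomology R X) where
  one := Cohomology.mk 0 oneCocycle

/-- The cup product on cohomology is associative and unital. -/
instance : GradedMonoid.GMonoid (Cohomology R X) where
  one_mul := by
    rintro ⟨n, a⟩
    obtain ⟨a, rfl⟩ := Cohomology.mk_surjective n a
    refine gradedMonoid_mk_eq (zero_add n) (cupCocycle 0 n oneCocycle a) a fun σ => ?_
    simp only [cupCocycle, LinearMap.mk₂_apply, cup, oneCocycle, one_mul, Simp.pull_pull]
    refine congrArg a.1 (Eq.trans (congrArg σ.pull ?_) (Simp.pull_id σ))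
    ext i
    simp [back]
  mul_one := by
    rintro ⟨n, a⟩
    obtain ⟨a, rfl⟩ := Cohomology.mk_surjective n a
    refine gradedMonoid_mk_eq (add_zero n) (cupCocycle n 0 a oneCocycle) a fun σ => ?_
    simp only [cupCocycle, LinearMap.mk₂_apply, cup, oneCocycle, mul_one, Simp.pull_pull]
    exact congrArg a.1 (Simp.pull_id σ)
  mul_assoc := by
    rintro ⟨p, a⟩ ⟨q, b⟩ ⟨r, c⟩
    obtain ⟨a, rfl⟩ := Cohomology.mk_surjective p a
    obtain ⟨b, rfl⟩ := Cohomology.mk_surjective q b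
    obtain ⟨c, rfl⟩ := Cohomology.mk_surjective r c
    refine gradedMonoid_mk_eq (add_assoc p q r) (cupCocycle (p + q) r (cupCocycle p q a b) c)
      (cupCocycle p (q + r) a (cupCocycle q r b c)) fun σ => ?_
    simp only [cupCocycle, LinearMap.mk₂_apply, cup, Simp.pull_pull, mul_assoc]
    refine congrArg₂ _ rfl (congrArg₂ _ rfl (congrArg c.1 (congrArg σ.pull ?_)))
    ext i
    simp [back, add_assoc]

/-- Singular cohomology with the cup product is a graded ring. -/
instance : DirectSum.GRing (Cohomology R X) where
  mul_zero {p q} a := map_zero (cupH p q a)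
  zero_mul {p q} b := LinearMap.map_zero₂ (cupH p q) b
  mul_add {p q} a b c := map_add (cupH p q a) b c
  add_mul {p q} a b c := LinearMap.map_add₂ (cupH p q) a b c
  natCast k := k • Cohomology.mk 0 oneCocycle
  natCast_zero := zero_smul _ _
  natCast_succ _ := succ_nsmul _ _
  intCast n := n • Cohomology.mk 0 oneCocycle
  intCast_ofNat _ := natCast_zsmul _ _
  intCast_negSucc_ofNat _ := negSucc_zsmul _ _

/-- The cohomology ring `H*(X; R) = ⨁ n, Hⁿ(X; R)`, with the cup product as multiplication. -/
abbrev CohomologyRing (R : Type w) [CommRing R] (X : Type u) [TopologicalSpace X] :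
    Type (max u w) :=
  ⨁ n, Cohomology R X n

/-! ### Induced maps -/

variable {Y : Type v} [TopologicalSpace Y]

/-- The map induced by `f : X → Y` on cocycles, `(f^# φ)(σ) = φ(f ∘ σ)`. -/
def pullbackCocycle (R : Type w) [CommRing R] (f : C(X, Y)) (n : ℕ) :
    cocycles R Y n →ₗ[R] cocycles R X n where
  toFun φ := ⟨fun σ => φ.1 (f.comp σ), by
    rw [mem_cocycles]
    ext σ
    exact congrFun (mem_cocycles.1 φ.2) (f.comp σ)⟩
  map_add' _ _ := rfl
  map_smul' _ _ := rfl

lemma pullback_mem (f : C(X, Y)) {n : ℕ} {φ : Cochain R Y n} (hφ : φ ∈ coboundaries R Y n) :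
    (fun σ => φ (f.comp σ)) ∈ coboundaries R X n := by
  cases n with
  | zero =>
    obtain rfl : φ = 0 := hφ
    exact zero_mem _
  | succ n =>
    obtain ⟨φ, rfl⟩ := hφ
    exact ⟨fun σ => φ (f.comp σ), rfl⟩

/-- The induced map `f^* : Hⁿ(Y; R) → Hⁿ(X; R)`. -/
def pullbackH (R : Type w) [CommRing R] (f : C(X, Y)) (n : ℕ) :
    Cohomology R Y n →ₗ[R] Cohomology R X n :=
  Submodule.mapQ _ _ (pullbackCocycle R f n) fun _ hφ => pullback_mem f hφ

/-- The induced map `f^* : H*(Y; R) → H*(X; R)`. -/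
def pullback (R : Type w) [CommRing R] (f : C(X, Y)) :
    CohomologyRing R Y →ₗ[R] CohomologyRing R X :=
  DirectSum.lmap (pullbackH R f)

/-- `J(f, g; R)`, the image of `f^* - g^* : H*(Y; R) → H*(X; R)`. -/
def J (R : Type w) [CommRing R] (f g : C(X, Y)) : Submodule R (CohomologyRing R X) :=
  LinearMap.range (pullback R f - pullback R g)

/-- `l.c.p. S` for a subset `S` of a ring: the least `n ≥ 0` such that every product of `n + 1`
elements of `S` vanishes, and `∞` if there is no such `n`. -/
def lcp {A : Type u} [Ring A] (S : Set A) : ℕ∞ :=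
  sInf ((fun n : ℕ => (n : ℕ∞)) ''
    {n : ℕ | ∀ x : Fin (n + 1) → A, (∀ i, x i ∈ S) → (List.ofFn x).prod = 0})

end SingularCohomology

end

namespace SingularCohomology

/-! ### Order reversal and the prism operator -/

section Vertices

/-! Only `≥` needs work, since `J` lies in the ideal it generates. Suppose every element of `J`
times any ring element stays in the left ideal `Ideal.span J`. Then that left ideal is two-sided,
and in a product of `k` of its elements all coefficients can be moved to the left, so the product
lies in the left ideal generated by `k`-fold products from `J`. If those vanish for `k = n + 1`, so
does every product of `n + 1` elements of the ideal (`lcp_eq_lcp_span`).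

The supposition follows from graded commutativity (`of_mul_of_comm`): `f^* - g^*` preserves degree,
so `J` is spanned by homogeneous elements, and these commute with homogeneous classes up to sign.

Graded commutativity comes from reversing the vertex order of simplices. With sign
`(-1)^(n(n+1)/2)`, reversal changes a cocycle only by a coboundary (`d_prism`), and it swaps the
factors of a cup product (`cup_reversal`). -/

/-- The map on the vertices of the `n`-simplex that reverses the order of all but the first `j`
vertices: the vertices `0, …, j - 1, n, n - 1, …, j`. -/
def revFrom (n j : ℕ) (x : Fin (n + 1)) : Fin (n + 1) :=
  ⟨if (x : ℕ) < j then x else n - (x - j), by split_ifs <;> omega⟩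

/-- The vertices `0, …, j, n, n - 1, …, j` of a top-dimensional simplex of the prism. -/
def prismVertex (n j : ℕ) (x : Fin (n + 2)) : Fin (n + 1) :=
  ⟨if (x : ℕ) ≤ j then min x n else n - (x - j - 1), by split_ifs <;> omega⟩

/-- The injection of vertices that misses `i`, for a natural number `i`. -/
def skip (n i : ℕ) (x : Fin (n + 1)) : Fin (n + 2) :=
  ⟨if (x : ℕ) < i then x else x + 1, by split_ifs <;> omega⟩

lemma succAbove_eq_skip {n : ℕ} (i : Fin (n + 2)) : i.succAbove = skip n i := by
  ext x
  simp only [skip, Fin.succAbove, Fin.lt_def]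
  split_ifs <;> simp_all

lemma revFrom_zero (n : ℕ) : revFrom n 0 = Fin.rev := by
  ext x
  simp only [revFrom, Fin.val_rev]
  simp

lemma revFrom_last (n : ℕ) : revFrom n (n + 1) = id := by
  ext x
  simp only [revFrom, id]
  split_ifs <;> omega

/-- For `j ≤ n` the vertex `j` occurs twice in `prismVertex n j`, at positions `j` and `n + 1`.
Dropping one or the other gives consecutive maps `revFrom`, so these faces telescope from `Fin.rev`
to `id`. -/
lemma prismVertex_comp_skip_self (n j : ℕ) :
    prismVertex n j ∘ skip n j = revFrom n j := by
  ext x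
  simp only [Function.comp, prismVertex, skip, revFrom]
  split_ifs <;> omega

lemma prismVertex_comp_skip_last (n j : ℕ) :
    prismVertex n j ∘ skip n (n + 1) = revFrom n (j + 1) := by
  ext x
  simp only [Function.comp, prismVertex, skip, revFrom]
  split_ifs <;> omega

/-- The remaining faces of the prism simplices are prism simplices over faces of the base; here the
dropped position is before the doubled vertex, and in `prismVertex_comp_skip_add` after it. -/
lemma prismVertex_comp_skip_of_le {n i j : ℕ} (hij : i ≤ j) (hj : j ≤ n) :
    prismVertex (n + 1) (j + 1) ∘ skip (n + 1) i = skip n i ∘ prismVertex n j := by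
  ext x
  simp only [Function.comp, prismVertex, skip]
  split_ifs <;> omega

lemma prismVertex_comp_skip_add {n j l : ℕ} (h : j + l ≤ n) :
    prismVertex (n + 1) j ∘ skip (n + 1) (j + 1 + l) = skip n (n + 1 - l) ∘ prismVertex n j := by
  ext x
  simp only [Function.comp, prismVertex, skip]
  split_ifs <;> omega

end Vertices

universe u v w

/-! ### Signed reversal of cocycles, and its homotopy to the identity. -/

section Reversal

variable {X : Type u} [TopologicalSpace X] {R : Type w} [CommRing R]

/-- The sign of the order-reversing permutation of the vertices of an `n`-simplex. -/
def revSign (R : Type w) [CommRing R] : ℕ → R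
  | 0 => 1
  | n + 1 => (-1) ^ (n + 1) * revSign R n

lemma revSign_add (p q : ℕ) :
    revSign R (p + q) = (-1) ^ (p * q) * (revSign R p * revSign R q) := by
  induction q with
  | zero => simp [revSign]
  | succ q ih =>
    rw [← add_assoc, revSign, ih, revSign, mul_add, mul_one, pow_add (-1 : R) (p * q),
      add_assoc, pow_add (-1 : R) p]
    ring

/-- The signed order reversal on cochains. -/
noncomputable def reversal {n : ℕ} (φ : Cochain R X n) : Cochain R X n :=
  fun σ => revSign R n * φ (σ.pull Fin.rev)

/-- The prism operator on cochains. -/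
noncomputable def prism {n : ℕ} (φ : Cochain R X (n + 1)) : Cochain R X n :=
  fun σ => ∑ j ∈ Finset.range (n + 1),
    (-1) ^ j * revSign R (n - j) * φ (σ.pull (prismVertex n j))

lemma d_apply_range {n : ℕ} (φ : Cochain R X n) (σ : Simp X (n + 1)) :
    d n φ σ = ∑ i ∈ Finset.range (n + 2), (-1) ^ i * φ (σ.pull (skip n i)) := by
  rw [d_apply, ← Fin.sum_univ_eq_sum_range (fun i => (-1) ^ i * φ (σ.pull (skip n i)))]
  simp only [succAbove_eq_skip]

/-- The ratio of consecutive weights in `prism`; it makes shared faces cancel. -/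
lemma revSign_sub {n j : ℕ} (hj : j ≤ n) :
    revSign R (n + 1 - j) = (-1) ^ (n + 1) * (-1) ^ j * revSign R (n - j) := by
  obtain ⟨k, rfl⟩ := Nat.exists_eq_add_of_le hj
  rw [show j + k + 1 - j = k + 1 by omega, show j + k - j = k by omega, revSign,
    ← pow_add, show j + k + 1 + j = (k + 1) + 2 * j by omega, pow_add _ (k + 1), pow_mul]
  simp

lemma sum_range_split {a b N : ℕ} (h : a + b = N) (F : ℕ → R) :
    ∑ i ∈ Finset.range N, F i = ∑ i ∈ Finset.range a, F i + ∑ i ∈ Finset.range b, F (a + i) := by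
  rw [← h, Finset.sum_range_add]

/-- The coboundary on the `j`-th simplex of the prism, split into its boundary and interior faces. -/
lemma d_apply_prismVertex {n j : ℕ} (hj : j ≤ n + 1) (φ : Cochain R X (n + 1))
    (σ : Simp X (n + 1)) :
    d (n + 1) φ (σ.pull (prismVertex (n + 1) j)) =
      ∑ i ∈ Finset.range j, (-1) ^ i * φ (σ.pull (prismVertex (n + 1) j ∘ skip (n + 1) i)) +
      (-1) ^ j * φ (σ.pull (revFrom (n + 1) j)) +
      ∑ l ∈ Finset.range (n + 1 - j), (-1) ^ (j + 1 + l) *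
        φ (σ.pull (prismVertex (n + 1) j ∘ skip (n + 1) (j + 1 + l))) +
      (-1) ^ (n + 2) * φ (σ.pull (revFrom (n + 1) (j + 1))) := by
  rw [d_apply_range, Finset.sum_range_succ,
    sum_range_split (a := j + 1) (b := n + 1 - j) (by omega), Finset.sum_range_succ _ j]
  simp only [Simp.pull_pull, prismVertex_comp_skip_self, prismVertex_comp_skip_last]

/-- Evaluate the vanishing `d φ` on all prism simplices over `σ` and add with weights: the boundary
faces telescope to `reversal φ - φ`, and the interior ones give `-d (prism φ)`. -/
lemma d_prism {n : ℕ} {φ : Cochain R X (n + 1)} (hφ : φ ∈ cocycles R X (n + 1)) :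
    d n (prism φ) = reversal φ - φ := by
  ext σ
  set D : ℕ → R := fun j => φ (σ.pull (revFrom (n + 1) j)) with hD
  set B : ℕ → ℕ → R := fun k j => φ (σ.pull (skip n k ∘ prismVertex n j)) with hB
  -- The telescoping potential: `E 0` is `reversal φ σ` and `E (n + 2)` is `φ σ`. The last index is
  -- separated because `revSign_sub` does not reach it.
  set E : ℕ → R := fun j => if j = n + 2 then D j else revSign R (n + 1 - j) * D j with hE
  have key : ∑ j ∈ Finset.range (n + 2), (-1) ^ j * revSign R (n + 1 - j) *
      d (n + 1) φ (σ.pull (prismVertex (n + 1) j)) = 0 := by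
    simp [mem_cocycles.1 hφ]
  have tele : ∑ j ∈ Finset.range (n + 2), (-1) ^ j * revSign R (n + 1 - j) *
      ((-1) ^ j * D j + (-1) ^ (n + 2) * D (j + 1)) = reversal φ σ - φ σ := by
    have e : ∀ j ∈ Finset.range (n + 2), (-1) ^ j * revSign R (n + 1 - j) *
        ((-1) ^ j * D j + (-1) ^ (n + 2) * D (j + 1)) = E j - E (j + 1) := by
      intro j hj
      have hj' := Finset.mem_range.1 hj
      have s : (-1 : R) ^ j * (-1) ^ j = 1 := by rw [← mul_pow]; simp
      have s' : (-1 : R) ^ (n + 1) * (-1) ^ (n + 1) = 1 := by rw [← mul_pow]; simp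
      simp only [hE, if_neg hj'.ne]
      rcases Nat.lt_succ_iff_lt_or_eq.1 hj' with h | rfl
      · rw [if_neg (by omega), revSign_sub (n := n) (j := j) (by omega),
          show n + 1 - (j + 1) = n - j by omega, pow_succ (-1 : R) (n + 1)]
        linear_combination ((-1) ^ (n + 1) * (-1) ^ j * revSign R (n - j) * D j
          - revSign R (n - j) * D (j + 1) * (-1) ^ (n + 1) * (-1) ^ (n + 1)) * s
          - revSign R (n - j) * D (j + 1) * s'
      · rw [if_pos rfl, Nat.sub_self, pow_succ (-1 : R) (n + 1)]
        simp only [revSign]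
        linear_combination (D (n + 1) - D (n + 1 + 1)) * s
    rw [Finset.sum_congr rfl e, Finset.sum_range_sub']
    simp [hE, hD, revFrom_zero, revFrom_last, reversal, Simp.pull_id]
  have interior : ∑ j ∈ Finset.range (n + 2), (-1) ^ j * revSign R (n + 1 - j) *
      (∑ i ∈ Finset.range j, (-1) ^ i * φ (σ.pull (prismVertex (n + 1) j ∘ skip (n + 1) i)) +
        ∑ l ∈ Finset.range (n + 1 - j), (-1) ^ (j + 1 + l) *
          φ (σ.pull (prismVertex (n + 1) j ∘ skip (n + 1) (j + 1 + l)))) =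
      - d n (prism φ) σ := by
    have lhs : d n (prism φ) σ = ∑ j ∈ Finset.range (n + 1), (-1) ^ j * revSign R (n - j) *
        ∑ k ∈ Finset.range (n + 2), (-1) ^ k * B k j := by
      simp only [d_apply_range, prism, Finset.mul_sum, Simp.pull_pull]
      rw [Finset.sum_comm]
      exact Finset.sum_congr rfl fun _ _ => Finset.sum_congr rfl fun _ _ => by ring
    simp only [mul_add, Finset.sum_add_distrib]
    -- The `j = 0` term of the first sum and the `j = n + 1` term of the second are empty. After the
    -- shift, the base faces `k ≤ j` come from simplex `j + 1` and those with `k > j` from simplex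
    -- `j`.
    rw [Finset.sum_range_succ', Finset.sum_range_succ (n := n + 1)
      (f := fun j => (-1) ^ j * revSign R (n + 1 - j) * ∑ l ∈ Finset.range (n + 1 - j), _)]
    simp only [Finset.range_zero, Finset.sum_empty, Nat.sub_self, mul_zero, add_zero]
    rw [lhs, ← Finset.sum_add_distrib, ← Finset.sum_neg_distrib]
    refine Finset.sum_congr rfl fun j hj => ?_
    have hj' := Finset.mem_range.1 hj
    have e1 : ∑ i ∈ Finset.range (j + 1), (-1) ^ i *
        φ (σ.pull (prismVertex (n + 1) (j + 1) ∘ skip (n + 1) i)) =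
        ∑ k ∈ Finset.range (j + 1), (-1) ^ k * B k j :=
      Finset.sum_congr rfl fun i hi => by
        have := Finset.mem_range.1 hi
        rw [prismVertex_comp_skip_of_le (by omega) (by omega)]
    have e2 : ∑ l ∈ Finset.range (n + 1 - j), (-1) ^ (j + 1 + l) *
        φ (σ.pull (prismVertex (n + 1) j ∘ skip (n + 1) (j + 1 + l))) =
        (-1) ^ (n + 1) * (-1) ^ j * -∑ k ∈ Finset.range (n + 1 - j),
          (-1) ^ (j + 1 + k) * B (j + 1 + k) j := by
      rw [← Finset.sum_range_reflect, ← Finset.sum_neg_distrib, Finset.mul_sum]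
      refine Finset.sum_congr rfl fun l hl => ?_
      have := Finset.mem_range.1 hl
      have sgn : (-1 : R) ^ (j + 1 + (n + 1 - j - 1 - l)) =
          -((-1) ^ (n + 1) * (-1) ^ j * (-1) ^ (j + 1 + l)) := by
        rw [← pow_add, ← pow_add, ← mul_neg_one (_ ^ _), ← pow_succ,
          show n + 1 + j + (j + 1 + l) + 1 =
            (j + 1 + (n + 1 - j - 1 - l)) + 2 * (j + 1 + l) by omega,
          pow_add _ _ (2 * _), pow_mul]
        simp
      rw [prismVertex_comp_skip_add (by omega), sgn,
        show n + 1 - (n + 1 - j - 1 - l) = j + 1 + l by omega]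
      ring
    have s : (-1 : R) ^ j * (-1) ^ j = 1 := by rw [← mul_pow]; simp
    have s' : (-1 : R) ^ (n + 1) * (-1) ^ (n + 1) = 1 := by rw [← mul_pow]; simp
    rw [e1, e2, sum_range_split (a := j + 1) (b := n + 1 - j) (N := n + 2) (by omega),
      revSign_sub (n := n) (j := j) (by omega), show n + 1 - (j + 1) = n - j by omega]
    generalize ∑ k ∈ Finset.range (n + 1 - j), (-1) ^ (j + 1 + k) * B (j + 1 + k) j = S
    generalize ∑ k ∈ Finset.range (j + 1), (-1) ^ k * B k j = T
    rw [pow_succ (-1 : R) j]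
    linear_combination (-(-1) ^ j * revSign R (n - j) * S) *
      (s * ((-1) ^ (n + 1) * (-1) ^ (n + 1)) + s')
  have split : ∑ j ∈ Finset.range (n + 2), (-1) ^ j * revSign R (n + 1 - j) *
      d (n + 1) φ (σ.pull (prismVertex (n + 1) j)) =
      (reversal φ σ - φ σ) - d n (prism φ) σ := by
    rw [← tele, sub_eq_add_neg _ (d n (prism φ) σ), ← interior, ← Finset.sum_add_distrib]
    refine Finset.sum_congr rfl fun j hj => ?_
    rw [d_apply_prismVertex (Nat.lt_succ_iff.1 (Finset.mem_range.1 hj))]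
    ring
  rw [key] at split
  exact (sub_eq_zero.1 split.symm).symm

lemma reversal_sub_mem_coboundaries {n : ℕ} {φ : Cochain R X n} (hφ : φ ∈ cocycles R X n) :
    reversal φ - φ ∈ coboundaries R X n := by
  cases n with
  | zero =>
    have : reversal φ - φ = 0 := by
      ext σ
      have : (Fin.rev : Fin (0 + 1) → Fin (0 + 1)) = id := by
        ext x
        simp
      simp [reversal, revSign, this, Simp.pull_id]
    rw [this]
    exact zero_mem _
  | succ n => exact ⟨prism φ, d_prism hφ⟩

/-! ### Graded commutativity of the cup product. -/

lemma reversal_mem_cocycles {n : ℕ} {φ : Cochain R X n} (hφ : φ ∈ cocycles R X n) :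
    reversal φ ∈ cocycles R X n := by
  simpa using add_mem (coboundaries_le_cocycles n (reversal_sub_mem_coboundaries hφ)) hφ

/-- Reversal exchanges front and back faces; the sign is the defect of multiplicativity in
`revSign_add`. -/
lemma cup_reversal {p q n : ℕ} (h : p + q = n) (φ : Cochain R X p) (ψ : Cochain R X q) :
    cup h (reversal φ) (reversal ψ) =
      (-1 : R) ^ (p * q) • reversal (cup (show q + p = n by omega) ψ φ) := by
  subst h
  ext σ
  have e1 : front (p := p) (n := p + q) (by omega) ∘ Fin.rev =
      Fin.rev ∘ back (p := q) (q := p) (by omega) := by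
    ext i
    simp only [Function.comp, front, back, Fin.val_rev]
    omega
  have e2 : back (p := p) (q := q) (n := p + q) rfl ∘ Fin.rev =
      Fin.rev ∘ front (by omega) := by
    ext i
    simp only [Function.comp, front, back, Fin.val_rev]
    omega
  have s : (-1 : R) ^ (p * q) * (-1) ^ (p * q) = 1 := by rw [← mul_pow]; simp
  simp only [cup, reversal, Pi.smul_apply, smul_eq_mul, Simp.pull_pull, revSign_add, e1, e2]
  rw [mul_assoc ((-1 : R) ^ (p * q)), ← mul_assoc ((-1 : R) ^ (p * q)), s]
  ring

/-- Graded commutativity of the cup product on cocycles, up to coboundaries. -/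
lemma cup_sub_cup_mem_coboundaries {p q n : ℕ} (h : p + q = n) {φ : Cochain R X p}
    (hφ : φ ∈ cocycles R X p) {ψ : Cochain R X q} (hψ : ψ ∈ cocycles R X q) :
    cup h φ ψ - (-1 : R) ^ (p * q) • cup (show q + p = n by omega) ψ φ ∈
      coboundaries R X n := by
  have hc : cup (show q + p = n by omega) ψ φ ∈ cocycles R X n := by
    obtain rfl : q + p = n := by omega
    exact (cupCocycle q p ⟨ψ, hψ⟩ ⟨φ, hφ⟩).2
  -- With `ρ` for reversal, `ρφ ⌣ ρψ - φ ⌣ ψ = (ρφ - φ) ⌣ ψ + ρφ ⌣ (ρψ - ψ)`.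
  have h1 := cup_mem_of_left h (reversal_sub_mem_coboundaries hφ) hψ
  have h2 := cup_mem_of_right h (reversal_mem_cocycles hφ) (reversal_sub_mem_coboundaries hψ)
  have h3 := Submodule.smul_mem _ ((-1 : R) ^ (p * q)) (reversal_sub_mem_coboundaries hc)
  convert sub_mem h3 (add_mem h1 h2) using 1
  rw [smul_sub, ← cup_reversal h]
  ext σ
  simp only [cup, Pi.sub_apply, Pi.add_apply]
  ring

/-- Compares classes whose degrees, such as `p + q` and `q + p`, are equal only propositionally. -/
lemma cohomologyMk_eq_of_sub_mem {m n : ℕ} (h : m = n) (a : cocycles R X m)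
    (b : cocycles R X n)
    (hab : (fun σ : Simp X n => a.1 (σ.pull (Fin.cast (by rw [h]))) - b.1 σ) ∈
      coboundaries R X n) :
    DirectSum.of (Cohomology R X) m (Cohomology.mk m a) =
      DirectSum.of (Cohomology R X) n (Cohomology.mk n b) := by
  subst h
  congr 1
  rw [← sub_eq_zero, ← map_sub, Cohomology.mk_eq_zero]
  convert hab using 1
  ext σ
  exact congrArg₂ _ (congrArg a.1 (Simp.pull_id σ)).symm rfl

/-- Graded commutativity of the cohomology ring. -/
theorem of_mul_of_comm {p q : ℕ} (a : Cohomology R X p) (b : Cohomology R X q) :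
    ∃ b' : Cohomology R X q, DirectSum.of (Cohomology R X) p a * DirectSum.of (Cohomology R X) q b =
      DirectSum.of (Cohomology R X) q b' * DirectSum.of (Cohomology R X) p a := by
  obtain ⟨a, rfl⟩ := Cohomology.mk_surjective p a
  obtain ⟨b, rfl⟩ := Cohomology.mk_surjective q b
  refine ⟨Cohomology.mk q ((-1 : R) ^ (p * q) • b), ?_⟩
  rw [DirectSum.of_mul_of, DirectSum.of_mul_of]
  refine cohomologyMk_eq_of_sub_mem (add_comm p q) (cupCocycle p q a b)
    (cupCocycle q p ((-1 : R) ^ (p * q) • b) a) ?_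
  convert cup_sub_cup_mem_coboundaries (add_comm p q) a.2 b.2 using 1
  ext σ
  simp only [cupCocycle, LinearMap.mk₂_apply, cup, Simp.pull_pull, Pi.sub_apply, Pi.smul_apply,
    smul_eq_mul, Submodule.coe_smul, mul_assoc]
  rfl

end Reversal

/-! ### Products in the ideal generated by a set -/

section Lcp

variable {A : Type u} [Ring A]

/-- The elements that are products of `k` elements of `S`. -/
def prods (S : Set A) (k : ℕ) : Set A :=
  {a | ∃ x : Fin k → A, (∀ i, x i ∈ S) ∧ (List.ofFn x).prod = a}

lemma mul_mem_prods {S : Set A} {k : ℕ} {a b : A} (ha : a ∈ S) (hb : b ∈ prods S k) :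
    a * b ∈ prods S (k + 1) := by
  obtain ⟨x, hx, rfl⟩ := hb
  refine ⟨Fin.cons a x, fun i => ?_, by simp [List.ofFn_succ]⟩
  cases i using Fin.cases with
  | zero => exact ha
  | succ i => exact hx i

/-- In a term `s * (c * w)`, `hS` rewrites `s * c` as a left combination of elements of `S`, each of
which lengthens the product `w` by one factor. -/
lemma mul_mem_span_prods {S : Set A} (hS : ∀ s ∈ S, ∀ a, s * a ∈ Ideal.span S) {k : ℕ} {y z : A}
    (hy : y ∈ Ideal.span S) (hz : z ∈ Ideal.span (prods S k)) :
    y * z ∈ Ideal.span (prods S (k + 1)) := by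
  have gen : ∀ y ∈ Ideal.span S, ∀ z ∈ prods S k, y * z ∈ Ideal.span (prods S (k + 1)) := by
    intro y hy z hz
    induction hy using Submodule.span_induction with
    | mem s hs => exact Ideal.subset_span (mul_mem_prods hs hz)
    | zero => simp
    | add a b _ _ ha hb => rw [add_mul]; exact add_mem ha hb
    | smul c a _ ha => rw [smul_eq_mul, mul_assoc]; exact Ideal.mul_mem_left _ _ ha
  induction hy using Submodule.span_induction with
  | mem s hs =>
    -- The coefficient `c` is general so that the induction on `z` can absorb scalars into it.
    have : ∀ c : A, s * (c * z) ∈ Ideal.span (prods S (k + 1)) := by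
      induction hz using Submodule.span_induction with
      | mem w hw => exact fun c => mul_assoc s c w ▸ gen _ (hS s hs c) w hw
      | zero => simp
      | add a b _ _ ha hb => exact fun c => by rw [mul_add, mul_add]; exact add_mem (ha c) (hb c)
      | smul e a _ ha => exact fun c => by rw [smul_eq_mul, ← mul_assoc c]; exact ha _
    simpa using this 1
  | zero => simp
  | add a b _ _ ha hb => rw [add_mul]; exact add_mem ha hb
  | smul c a _ ha => rw [smul_eq_mul, mul_assoc]; exact Ideal.mul_mem_left _ _ ha

/-- The two-sided ideal is additively generated by the products `a * s * b`, and `hS` handles `s *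
b`. -/
lemma mem_span_of_mem_twoSidedIdeal_span {S : Set A} (hS : ∀ s ∈ S, ∀ a, s * a ∈ Ideal.span S)
    {y : A} (hy : y ∈ TwoSidedIdeal.span S) : y ∈ Ideal.span S := by
  rw [TwoSidedIdeal.mem_span_iff_mem_addSubgroup_closure] at hy
  induction hy using AddSubgroup.closure_induction with
  | mem x hx =>
    obtain ⟨_, ⟨a, -, s, hs, rfl⟩, b, -, rfl⟩ := hx
    simp only [mul_assoc]
    exact Ideal.mul_mem_left _ _ (hS s hs b)
  | zero => exact zero_mem _
  | add a b _ _ ha hb => exact add_mem ha hb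
  | neg a _ ha => exact neg_mem ha

/-- If the left ideal generated by `S` is two-sided, then passing from `S` to the two-sided ideal
it generates does not change the length of nonvanishing products. -/
theorem lcp_eq_lcp_span {S : Set A} (hS : ∀ s ∈ S, ∀ a, s * a ∈ Ideal.span S) :
    lcp S = lcp (TwoSidedIdeal.span S : Set A) := by
  have key : ∀ k (x : Fin k → A), (∀ i, x i ∈ TwoSidedIdeal.span S) →
      (List.ofFn x).prod ∈ Ideal.span (prods S k) := by
    intro k
    induction k with
    | zero => exact fun x _ => Ideal.subset_span ⟨x, finZeroElim, rfl⟩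
    | succ k ih =>
      intro x hx
      rw [List.ofFn_succ, List.prod_cons]
      exact mul_mem_span_prods hS (mem_span_of_mem_twoSidedIdeal_span hS (hx 0))
        (ih _ fun i => hx i.succ)
  unfold lcp
  congr 2
  ext n
  refine ⟨fun h x hx => ?_, fun h x hx => h x fun i => TwoSidedIdeal.subset_span (hx i)⟩
  have hbot : Ideal.span (prods S (n + 1)) = ⊥ := by
    rw [Ideal.span_eq_bot]
    rintro _ ⟨y, hy, rfl⟩
    exact h y hy
  simpa [hbot] using key _ x hx

end Lcp

/-! ### The image of `f^* - g^*` -/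

section Image

variable {X : Type u} [TopologicalSpace X] {Y : Type v} [TopologicalSpace Y]
  {R : Type w} [CommRing R]

lemma pullback_sub_pullback_of (f g : C(X, Y)) {p : ℕ} (y : Cohomology R Y p) :
    (pullback R f - pullback R g) (DirectSum.of (Cohomology R Y) p y) =
      DirectSum.of (Cohomology R X) p (pullbackH R f p y - pullbackH R g p y) := by
  rw [map_sub]
  exact congrArg₂ (· - ·) (DirectSum.lmap_lof (pullbackH R f) p y)
    (DirectSum.lmap_lof (pullbackH R g) p y)

lemma mul_mem_span_J (f g : C(X, Y)) {s : CohomologyRing R X} (hs : s ∈ J R f g)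
    (a : CohomologyRing R X) :
    s * a ∈ Ideal.span (J R f g : Set (CohomologyRing R X)) := by
  obtain ⟨y, rfl⟩ := hs
  induction y using DirectSum.induction_on with
  | zero => simp
  | add y z hy hz => rw [map_add, add_mul]; exact add_mem hy hz
  | of p y =>
    induction a using DirectSum.induction_on with
    | zero => simp
    | add a b ha hb => rw [mul_add]; exact add_mem ha hb
    -- Both factors are now homogeneous, so they can be interchanged, the sign being absorbed into
    -- `a'`.
    | of q a =>
      have hmem := Ideal.subset_span (α := CohomologyRing R X)
        (show _ ∈ (J R f g : Set (CohomologyRing R X)) from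
          ⟨DirectSum.of (Cohomology R Y) p y, rfl⟩)
      rw [pullback_sub_pullback_of] at hmem ⊢
      obtain ⟨a', ha'⟩ := of_mul_of_comm (pullbackH R f p y - pullbackH R g p y) a
      rw [ha']
      exact Ideal.mul_mem_left _ _ hmem

end Image

end SingularCohomology

theorem mainTheorem3 {R : Type*} [CommRing R]
    {X : Type*} [TopologicalSpace X] [PathConnectedSpace X]
    {Y : Type*} [TopologicalSpace Y] [PathConnectedSpace Y] (f g : C(X, Y)) :
    SingularCohomology.lcp
        (SingularCohomology.J R f g : Set (SingularCohomology.CohomologyRing R X)) =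
      SingularCohomology.lcp
        (TwoSidedIdeal.span
            (SingularCohomology.J R f g : Set (SingularCohomology.CohomologyRing R X)) :
          Set (SingularCohomology.CohomologyRing R X)) :=
  SingularCohomology.lcp_eq_lcp_span fun _ hs a => SingularCohomology.mul_mem_span_J f g hs a
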